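/- Let $B$ be a stationary Bratteli diagram with finite vertex set $V$ on every level $\ge 1$, incidence matrix $F$ (where $F_{vw}$ is the number of edges from the vertex $w$ of level $k$ to the vertex $v$ of level $k+1$, $k\ge 1$; no zero rows or columns), and $h_v\ge 1$ edges from the top vertex $v_0$ to the vertex $v$ of level $1$. Let $X_B$ be the space of infinite paths starting at $v_0$, let $\mathcal R$ be the tail equivalence relation on $X_B$, and let $A=F^T$. A class of vertices is a maximal set of mutually reachable vertices whose diagonal block $F_\alpha$ of $F$ is nonzero; a class $\alpha$ has access to a vertex $v$ if there is a finite (possibly trivial) path from $v$ to a vertex of $\alpha$; $\alpha$ is distinguished if the spectral radius of $F_\alpha$ is larger than that of $F_\beta$ for every class $\beta\ne\alpha$ to which $\alpha$ has access. Let $\alpha$ be a distinguished class and let $\lambda$ be the spectral radius of $F_\alpha$. Let $x=(x_v)_{v\in V}$ be the non-negative vector with $Ax=\lambda x$ that vanishes at all vertices to which $\alpha$ has no access, normalised by $\sum_v h_v x_v=1$ (so $x$ is a probability vector when all $h_v=1$). Number the vertices to which $\alpha$ has access by $1,\dots,n$ so that $\alpha=\{m+1,\dots,n\}$; the vector $(x_1,\dots,x_n)^T$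 is called the reduced vector. Let $\mu$ be a non-atomic ergodic $\mathcal R$-invariant Borel probability measure on $X_B$ that is defined by $\lambda$ and $x$, i.e. the set of all infinite paths that extend a given finite path with $N\ge 1$ edges from $v_0$ to a vertex $i$ has measure $x_i/\lambda^{N-1}$. The measure $\mu$ is called good if for all clopen subsets $U,U'$ of the support of $\mu$ with $\mu(U)<\mu(U')$ there is a clopen subset $W\subset U'$ of the support with $\mu(W)=\mu(U)$. (1) The measure $\mu$ is good if and only if there exists $R\in\mathbb N$ such that $\lambda^R x_1,\dots,\lambda^R x_m$ belong to the additive group generated by $x_{m+1},\dots,x_n$. (2) Suppose that $\mu(U)$ is rational for every clopen subset $U$ of the support of $\mu$, and write the reduced vector as $(p_1/q,\dots,p_n/q)^T$ with natural numbers $p_i$ and $q\geq 1$ such that $\gcd(p_1,\dots,p_n)=1$. Then $\lambda$ is a natural number, and $\mu$ is good if and only if $\gcd(p_{m+1},\dots,p_n)$ divides $\lambda^R$ for some $R\in\mathbb N$. -/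

import Mathlib

open MeasureTheory

/-- A stationary Bratteli diagram.  Level `0` is the single vertex `v₀`, every later level is a copy
of `V`.  There are `h v` edges from `v₀` to the vertex `v` of level `1`, and `F v w` edges from the
vertex `w` of level `n` to the vertex `v` of level `n + 1`, for every `n ≥ 1`. -/
structure StationaryBratteli (V : Type*) where
  /-- the incidence matrix: rows are ranges, columns are sources -/
  F : Matrix V V ℕ
  /-- the numbers of edges leaving `v₀` -/
  h : V → ℕ
  /-- every vertex of level `1` receives an edge -/
  h_pos : ∀ v, 0 < h v
  /-- every vertex of level `≥ 2` receives an edge -/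
  row_ne : ∀ v, ∃ w, F v w ≠ 0
  /-- every vertex of level `≥ 1` emits an edge -/
  col_ne : ∀ w, ∃ v, F v w ≠ 0

namespace StationaryBratteli

variable {V : Type*} (B : StationaryBratteli V)

/-- `B.Edge n` is the set of edges between the levels `n` and `n + 1`.  For `n ≥ 1` an edge is a
pair (source, range) together with a label. -/
def Edge : ℕ → Type _
  | 0 => Σ v : V, Fin (B.h v)
  | _ + 1 => Σ e : V × V, Fin (B.F e.2 e.1)

/-- The range of an edge between the levels `n` and `n + 1`. -/
def range : (n : ℕ) → B.Edge n → V
  | 0, e => e.1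
  | _ + 1, e => e.1.2

/-- The source of an edge between the levels `n + 1` and `n + 2`. -/
def source (n : ℕ) (e : B.Edge (n + 1)) : V := e.1.1

instance (n : ℕ) : TopologicalSpace (B.Edge n) := ⊥

instance (n : ℕ) : DiscreteTopology (B.Edge n) := ⟨rfl⟩

/-- The space of infinite paths starting at `v₀`, a subspace of the product of the discrete edge
sets; its topology is the one generated by the cylinder sets. -/
def PathSpace : Type _ :=
  {p : (n : ℕ) → B.Edge n // ∀ n, B.source n (p (n + 1)) = B.range n (p n)}

instance : TopologicalSpace B.PathSpace :=
  inferInstanceAs (TopologicalSpace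
    {p : (n : ℕ) → B.Edge n // ∀ n, B.source n (p (n + 1)) = B.range n (p n)})

instance : MeasurableSpace B.PathSpace := borel _

instance : BorelSpace B.PathSpace := ⟨rfl⟩

variable {B}

/-- The cylinder set of the finite path formed by the first `n + 1` edges of `p`.  Every finite path
starting at `v₀` extends to an infinite one, so that every cylinder set is of this form. -/
def cylinder (p : B.PathSpace) (n : ℕ) : Set B.PathSpace :=
  {q | ∀ i ≤ n, q.1 i = p.1 i}

/-- The vertex in which the finite path formed by the first `n + 1` edges of `p` ends. -/
def endVertex (p : B.PathSpace) (n : ℕ) : V := B.range n (p.1 n)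

/-- Tail equivalence of infinite paths. -/
def TailEquiv (p q : B.PathSpace) : Prop := ∃ N, ∀ n ≥ N, p.1 n = q.1 n

/-- Invariance under tail equivalence: cylinder sets of finite paths with the same length and the
same final vertex have equal measure. -/
def IsTailInvariant (μ : Measure B.PathSpace) : Prop :=
  ∀ (p q : B.PathSpace) (n : ℕ), endVertex p n = endVertex q n →
    μ (cylinder p n) = μ (cylinder q n)

/-- Ergodicity with respect to tail equivalence. -/
def IsTailErgodic (μ : Measure B.PathSpace) : Prop :=
  ∀ S : Set B.PathSpace, MeasurableSet S → (∀ p q, TailEquiv p q → (p ∈ S ↔ q ∈ S)) →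
    μ S = 0 ∨ μ Sᶜ = 0

variable (B)

/-- There is a finite (possibly trivial) path from a vertex `w` to a vertex `v` going through
consecutive levels `≥ 1`. -/
def Reach (w v : V) : Prop := Relation.ReflTransGen (fun a b => B.F b a ≠ 0) w v

/-- `α` is a class of vertices: a maximal set of vertices that reach each other, whose diagonal
block of the incidence matrix is nonzero (and hence irreducible). -/
def IsClass (α : Finset V) : Prop :=
  ∃ a, Relation.TransGen (fun a b => B.F b a ≠ 0) a a ∧
    ∀ v, v ∈ α ↔ B.Reach a v ∧ B.Reach v a

/-- The set of all vertices to which the class `α` has access: those from which `α` is reached.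
It contains `α`. -/
noncomputable def accessible [Fintype V] (α : Finset V) : Finset V :=
  open Classical in Finset.univ.filter (fun i => ∃ a ∈ α, B.Reach i a)

/-- The spectral radius of the diagonal block of the incidence matrix that belongs to `α`. -/
noncomputable def rho [DecidableEq V] (α : Finset V) : ℝ :=
  (spectralRadius ℂ (Matrix.of fun v w : α => (B.F v w : ℂ))).toReal

/-- A class is distinguished if its spectral radius exceeds that of every other class to which it
has access. -/
def IsDistinguishedClass [Fintype V] [DecidableEq V] (α : Finset V) : Prop :=
  B.IsClass α ∧
    ∀ β : Finset V, B.IsClass β → β ≠ α → β ⊆ B.accessible α → B.rho β < B.rho α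

/-- `x` is a nonnegative eigenvector of the transposed incidence matrix `A = Fᵀ` for the eigenvalue
`lam`, which vanishes outside the vertices to which `α` has access and is normalised so that the
cylinder sets of length one have total mass `1`. (If `h = 1`, then `x` is a probability vector.)
The reduced vector is the restriction of `x` to `B.accessible α`. -/
structure IsEigenvectorOf [Fintype V] (α : Finset V) (lam : ℝ) (x : V → ℝ) : Prop where
  nonneg : ∀ i, 0 ≤ x i
  eigen : (B.F.map (Nat.cast : ℕ → ℝ)).transpose.mulVec x = lam • x
  zero_off : ∀ i, i ∉ B.accessible α → x i = 0
  normalised : ∑ i, (B.h i : ℝ) * x i = 1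

variable {B}

/-- `μ` is the measure defined by the eigenvalue `lam` and the eigenvector `x`: the cylinder set of
a finite path with `N` edges that ends in the vertex `i` has measure `x i / lam ^ (N - 1)`; here
`N = n + 1`. -/
def IsDefinedBy (μ : Measure B.PathSpace) (lam : ℝ) (x : V → ℝ) : Prop :=
  ∀ (p : B.PathSpace) (n : ℕ),
    μ (cylinder p n) = ENNReal.ofReal (x (endVertex p n) / lam ^ n)

end StationaryBratteli

/-- A clopen set `V` is good for `ν` if the measure of every clopen set of smaller measure is the
measure of some clopen subset of `V`. -/
def IsGoodSet {Y : Type*} [TopologicalSpace Y] [MeasurableSpace Y] (ν : Measure Y)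
    (V : Set Y) : Prop :=
  ∀ U : Set Y, IsClopen U → ν U < ν V → ∃ W : Set Y, IsClopen W ∧ W ⊆ V ∧ ν W = ν U

/-- A measure is good if every clopen set is good for it. -/
def IsGoodMeasure {Y : Type*} [TopologicalSpace Y] [MeasurableSpace Y] (ν : Measure Y) : Prop :=
  ∀ V : Set Y, IsClopen V → IsGoodSet ν V

/-- The clopen values set of a (finite) measure. -/
def clopenValues {Y : Type*} [TopologicalSpace Y] [MeasurableSpace Y] (ν : Measure Y) : Set ℝ :=
  {r | ∃ U : Set Y, IsClopen U ∧ ν.real U = r}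

/-- The measure `μ`, considered as a (full) measure on its topological support. -/
noncomputable def onSupport {X : Type*} [TopologicalSpace X] [MeasurableSpace X]
    (μ : Measure X) : Measure μ.support :=
  μ.comap Subtype.val

/-!
Goodness of a measure on its support is goodness on the whole path space, because the path space is
profinite and so clopen subsets of the support extend to clopen sets. A clopen set is a finite union
of cylinder sets of any large length `N + 1`; its measure is `lam⁻ᴺ ∑ c v * x v`, where `c v` counts
the prefixes of its elements that end in `v`. Hence everything is decided by which vectors `c` occur.

The eigenvector is positive exactly on the vertices to which `α` has access: otherwise a terminal
class of its support would lie below `α` and have spectral radius at least `lam`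
(`IsEigenvectorOf.exists_mem_ne_zero`). Up to null sets, a path that enters `α` therefore stays
there.

Ergodicity is used twice, both times through events described by the vertices a path eventually
runs through. Almost every path ends up in `α`, so that any clopen set is almost exhausted by its
paths that have already entered `α` (`IsEigenvectorOf.eventually_lt_real`). And the diagonal block
of `α` is primitive (`IsEigenvectorOf.exists_block_pow_pos`): if two vertices of `α` could never be
driven to a common vertex in equally many steps, then the forward orbit of one of them would define
a tail event of intermediate measure. A primitive block contracts the negative part of a vector, so
that its powers make each integer vector `z` with `∑ x a * z a > 0` nonnegative
(`exists_pow_mulVec_nonneg`).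

If the scaled weights lie in the group generated by the weights of `α`, then `lamᴺ * μ U` is
`∑ x a * z a` for an integer vector `z` on `α`. For `μ U < μ U'`, let `c` count the prefixes of
elements of `U'` that end in `α`; for large `N` both `z` and `c - z` have positive `x`-mass. Powers
of the block make both of them nonnegative, and the image of `z` then prescribes how many prefixes
to select in `U'` to obtain a clopen subset of measure `μ U`. Conversely, goodness lets a cylinder
set of measure `x i` be replaced by a clopen set of paths that have entered `α`, and the formula for
its measure shows that `lamᴺ * x i` lies in the group.

For rational weights `p i / q` the group consists of the multiples of `gcd (p a : a ∈ α) / q`, and a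
Bézout combination of all the `p i` shows that `lam` is an integer.
-/

/-! ### Goodness on the support of a measure -/

section Support

variable {X : Type*} [TopologicalSpace X]

/-- Every clopen subset of a closed subspace of a profinite space is the trace of a clopen set. -/
lemma exists_isClopen_preimage_val_eq [CompactSpace X] [T2Space X] [TotallyDisconnectedSpace X]
    {K : Set X} (hK : IsClosed K) {U : Set K} (hU : IsClopen U) :
    ∃ C : Set X, IsClopen C ∧ Subtype.val ⁻¹' C = U := by
  have h1 : IsClosed (Subtype.val '' U : Set X) := hK.isClosedMap_subtype_val _ hU.isClosed
  have h2 : IsClosed (Subtype.val '' Uᶜ : Set X) :=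
    hK.isClosedMap_subtype_val _ hU.compl.isClosed
  obtain ⟨C, hC, h3, h4⟩ := exists_clopen_of_closed_subset_open h1 h2.isOpen_compl (by
    rintro _ ⟨a, ha, rfl⟩ ⟨b, hb, hab⟩
    exact hb (Subtype.val_injective hab ▸ ha))
  refine ⟨C, hC, Set.ext fun a => ⟨fun ha => ?_, fun ha => h3 ⟨a, ha, rfl⟩⟩⟩
  by_contra hn
  exact h4 ha ⟨a, hn, rfl⟩

variable [MeasurableSpace X] [BorelSpace X]

lemma onSupport_preimage_val [HereditarilyLindelofSpace X] (μ : Measure X) (C : Set X) :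
    onSupport μ (Subtype.val ⁻¹' C) = μ C := by
  have hm : MeasurableSet μ.support := Measure.isClosed_support.measurableSet
  rw [onSupport, (MeasurableEmbedding.subtype_coe hm).comap_apply, Subtype.image_preimage_coe,
    Set.inter_comm]
  exact measure_inter_conull Measure.measure_compl_support

/-- On a second countable profinite space, clopen subsets of the support can be replaced by clopen
subsets of the whole space. -/
lemma isGoodMeasure_onSupport_iff [CompactSpace X] [T2Space X] [TotallyDisconnectedSpace X]
    [HereditarilyLindelofSpace X] (μ : Measure X) :
    IsGoodMeasure (onSupport μ) ↔ IsGoodMeasure μ := by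
  constructor
  · intro h C' hC' C hC hlt
    obtain ⟨W, hW, hWC, hWm⟩ := h (Subtype.val ⁻¹' C') (hC'.preimage continuous_subtype_val)
      (Subtype.val ⁻¹' C) (hC.preimage continuous_subtype_val)
      (by simpa only [onSupport_preimage_val] using hlt)
    obtain ⟨D, hD, rfl⟩ := exists_isClopen_preimage_val_eq Measure.isClosed_support hW
    refine ⟨D ∩ C', hD.inter hC', Set.inter_subset_right, ?_⟩
    rw [← onSupport_preimage_val, Set.preimage_inter, Set.inter_eq_left.2 hWC, hWm,
      onSupport_preimage_val]
  · intro h U' hU' U hU hlt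
    obtain ⟨C', hC', rfl⟩ := exists_isClopen_preimage_val_eq Measure.isClosed_support hU'
    obtain ⟨C, hC, rfl⟩ := exists_isClopen_preimage_val_eq Measure.isClosed_support hU
    simp only [onSupport_preimage_val] at hlt
    obtain ⟨W, hW, hWC, hWm⟩ := h C' hC' C hC hlt
    exact ⟨Subtype.val ⁻¹' W, hW.preimage continuous_subtype_val, Set.preimage_mono hWC, by
      simpa only [onSupport_preimage_val] using hWm⟩

end Support

namespace StationaryBratteli

variable {V : Type*} {B : StationaryBratteli V}

/-! ### The path space -/

instance [Finite V] (n : ℕ) : Finite (B.Edge n) := by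
  cases n with
  | zero => exact inferInstanceAs (Finite (Σ v : V, Fin (B.h v)))
  | succ n => exact inferInstanceAs (Finite (Σ e : V × V, Fin (B.F e.2 e.1)))

lemma isClosed_paths : IsClosed
    {p : (n : ℕ) → B.Edge n | ∀ n, B.source n (p (n + 1)) = B.range n (p n)} := by
  let _ : TopologicalSpace V := ⊥
  have : DiscreteTopology V := ⟨rfl⟩
  simp only [Set.ofPred_forall]
  exact isClosed_iInter fun n => isClosed_eq
    ((continuous_of_discreteTopology (f := B.source n)).comp (continuous_apply (n + 1)))
    ((continuous_of_discreteTopology (f := B.range n)).comp (continuous_apply n))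

instance [Finite V] : CompactSpace B.PathSpace :=
  isCompact_iff_compactSpace.1 isClosed_paths.isCompact

instance : T2Space B.PathSpace :=
  inferInstanceAs (T2Space
    {p : (n : ℕ) → B.Edge n // ∀ n, B.source n (p (n + 1)) = B.range n (p n)})

instance : TotallyDisconnectedSpace B.PathSpace :=
  inferInstanceAs (TotallyDisconnectedSpace
    {p : (n : ℕ) → B.Edge n // ∀ n, B.source n (p (n + 1)) = B.range n (p n)})

instance [Finite V] : SecondCountableTopology B.PathSpace :=
  have (n : ℕ) : SecondCountableTopology (B.Edge n) :=
    DiscreteTopology.secondCountableTopology_of_countable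
  Topology.IsInducing.secondCountableTopology
    (f := fun p : B.PathSpace => (p.1 : (n : ℕ) → B.Edge n)) ⟨rfl⟩

lemma continuous_edge (n : ℕ) : Continuous fun p : B.PathSpace => p.1 n :=
  (continuous_apply n).comp continuous_subtype_val

lemma endVertex_congr {p q : B.PathSpace} {n : ℕ} (h : p.1 n = q.1 n) :
    endVertex p n = endVertex q n :=
  congrArg (B.range n) h

lemma isClopen_endVertex_mem (s : Set V) (n : ℕ) :
    IsClopen {p : B.PathSpace | endVertex p n ∈ s} :=
  (isClopen_discrete (B.range n ⁻¹' s)).preimage (continuous_edge n)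

lemma F_endVertex_ne_zero (p : B.PathSpace) (n : ℕ) :
    B.F (endVertex p (n + 1)) (endVertex p n) ≠ 0 := by
  intro h
  have h1 : (p.1 (n + 1)).1.1 = endVertex p n := p.2 n
  have h2 : (p.1 (n + 1)).1.2 = endVertex p (n + 1) := rfl
  have := (p.1 (n + 1)).2
  rw [h1, h2, h] at this
  exact this.elim0

/-- The finite path formed by the first `n + 1` edges. -/
def prefixMap (n : ℕ) (p : B.PathSpace) : (i : Fin (n + 1)) → B.Edge i := fun i => p.1 i

lemma prefixMap_eq_iff {n : ℕ} {p q : B.PathSpace} :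
    prefixMap n q = prefixMap n p ↔ q ∈ cylinder p n := by
  constructor
  · intro h i hi
    exact congrFun h ⟨i, Nat.lt_succ_of_le hi⟩
  · intro h
    funext i
    exact h i (Nat.le_of_lt_succ i.2)

lemma continuous_prefixMap (n : ℕ) : Continuous (prefixMap (B := B) n) :=
  continuous_pi fun i => continuous_edge i

lemma self_mem_cylinder (p : B.PathSpace) (n : ℕ) : p ∈ cylinder p n := fun _ _ => rfl

lemma isClopen_preimage_prefixMap (n : ℕ) (T : Set ((i : Fin (n + 1)) → B.Edge i)) :
    IsClopen (prefixMap n ⁻¹' T) :=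
  (isClopen_discrete T).preimage (continuous_prefixMap n)

lemma cylinder_eq_preimage (p : B.PathSpace) (n : ℕ) :
    cylinder p n = prefixMap n ⁻¹' {prefixMap n p} :=
  Set.ext fun _ => prefixMap_eq_iff.symm

lemma isClopen_cylinder (p : B.PathSpace) (n : ℕ) : IsClopen (cylinder p n) :=
  cylinder_eq_preimage p n ▸ isClopen_preimage_prefixMap n _

lemma exists_cylinder_subset {U : Set B.PathSpace} (hU : IsOpen U) {p : B.PathSpace}
    (hp : p ∈ U) : ∃ n, cylinder p n ⊆ U := by
  obtain ⟨O, hO, rfl⟩ := isOpen_induced_iff.1 hU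
  obtain ⟨I, u, hu, hI⟩ := isOpen_pi_iff.1 hO p.1 hp
  refine ⟨I.sup id, fun q hq => hI fun i hi => ?_⟩
  rw [hq i (Finset.le_sup (f := id) hi)]
  exact (hu i hi).2

/-- A clopen set is a union of cylinder sets of any sufficiently large length. -/
lemma exists_forall_cylinder_subset [Finite V] {U : Set B.PathSpace} (hU : IsClopen U) :
    ∃ N, ∀ n ≥ N, ∀ p ∈ U, cylinder p n ⊆ U := by
  choose! f hf using fun p (hp : p ∈ U) => exists_cylinder_subset hU.isOpen hp
  obtain ⟨t, htU⟩ := hU.isClosed.isCompact.elim_nhds_subcover' (fun p _ => cylinder p (f p))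
    fun p _ => (isClopen_cylinder p _).isOpen.mem_nhds (self_mem_cylinder p _)
  refine ⟨t.sup fun p => f p, fun n hn p hp q hq => ?_⟩
  obtain ⟨r, hr, hpr⟩ := Set.mem_iUnion₂.1 (htU hp)
  have hrn : f r ≤ n := (Finset.le_sup (f := fun p : U => f p) hr).trans hn
  exact hf r r.2 fun i hi => (hq i (hi.trans hrn)).trans (hpr i hi)

/-- Every finite path extends to an infinite one. -/
lemma exists_path_extending (p : (n : ℕ) → B.Edge n) (n : ℕ)
    (h : ∀ i < n, B.source i (p (i + 1)) = B.range i (p i)) :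
    ∃ q : B.PathSpace, ∀ i ≤ n, q.1 i = p i := by
  have hex : ∀ (i : ℕ) (e : B.Edge i), ∃ e' : B.Edge (i + 1), B.source i e' = B.range i e := by
    intro i e
    obtain ⟨v, hv⟩ := B.col_ne (B.range i e)
    exact ⟨⟨(B.range i e, v), ⟨0, Nat.pos_of_ne_zero hv⟩⟩, rfl⟩
  choose g hg using hex
  let q : (n : ℕ) → B.Edge n :=
    fun k => Nat.rec (p 0) (fun i e => if i < n then p (i + 1) else g i e) k
  have hq : ∀ i ≤ n, q i = p i := by
    intro i hi
    cases i with
    | zero => rfl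
    | succ i => exact if_pos hi
  refine ⟨⟨q, fun i => ?_⟩, hq⟩
  by_cases hi : i < n
  · rw [hq i hi.le, hq (i + 1) hi]
    exact h i hi
  · have : q (i + 1) = g i (q i) := if_neg hi
    rw [this, hg]

lemma exists_path_through_edge (p : B.PathSpace) (n : ℕ) (e : B.Edge (n + 1))
    (he : B.source n e = endVertex p n) :
    ∃ q ∈ cylinder p n, q.1 (n + 1) = e := by
  obtain ⟨q, hq⟩ := exists_path_extending (Function.update p.1 (n + 1) e) (n + 1) (by
    intro i hi
    rw [Function.update_of_ne (a := i) (by omega)]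
    rcases eq_or_ne i n with rfl | hin
    · rw [Function.update_self]
      exact he
    · rw [Function.update_of_ne (by omega)]
      exact p.2 i)
  refine ⟨q, fun i hi => ?_, ?_⟩
  · rw [hq i (by omega), Function.update_of_ne (by omega)]
  · rw [hq _ le_rfl, Function.update_self]

lemma exists_endVertex_zero_eq (p : B.PathSpace) (v : V) :
    ∃ q : B.PathSpace, endVertex q 0 = v := by
  obtain ⟨q, hq⟩ := exists_path_extending (Function.update p.1 0 ⟨v, ⟨0, B.h_pos v⟩⟩) 0
    (fun i hi => absurd hi (Nat.not_lt_zero i))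
  exact ⟨q, congrArg (B.range 0) ((hq 0 le_rfl).trans (Function.update_self ..))⟩

end StationaryBratteli

namespace StationaryBratteli

variable {V : Type*} {B : StationaryBratteli V}

/-! ### Counting finite paths in clopen sets -/

lemma cylinder_anti (p : B.PathSpace) {m n : ℕ} (h : m ≤ n) : cylinder p n ⊆ cylinder p m :=
  fun _ hq i hi => hq i (hi.trans h)

lemma endVertex_eq_of_mem_cylinder {p q : B.PathSpace} {n : ℕ} (h : q ∈ cylinder p n) :
    endVertex q n = endVertex p n :=
  endVertex_congr (h n le_rfl)

/-- The finite paths with `n + 1` edges that end in `v` and are prefixes of elements of `U`. -/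
def prefixes (U : Set B.PathSpace) (n : ℕ) (v : V) : Set ((i : Fin (n + 1)) → B.Edge i) :=
  prefixMap n '' {p | p ∈ U ∧ endVertex p n = v}

lemma prefixes_subset_univ (U : Set B.PathSpace) (n : ℕ) (v : V) :
    prefixes U n v ⊆ prefixes Set.univ n v :=
  Set.image_mono fun _ hp => ⟨trivial, hp.2⟩

lemma endVertex_eq_of_prefixMap_mem {U : Set B.PathSpace} {n : ℕ} {v : V} {p : B.PathSpace}
    (h : prefixMap n p ∈ prefixes U n v) : endVertex p n = v := by
  obtain ⟨q, ⟨-, hq⟩, hqp⟩ := h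
  rw [← hq, endVertex_eq_of_mem_cylinder (prefixMap_eq_iff.1 hqp)]

lemma mem_of_prefixMap_mem {U : Set B.PathSpace} {n : ℕ} {v : V} {p : B.PathSpace}
    (hU : ∀ p ∈ U, cylinder p n ⊆ U) (h : prefixMap n p ∈ prefixes U n v) : p ∈ U := by
  obtain ⟨q, ⟨hq, -⟩, hqp⟩ := h
  exact hU q hq (prefixMap_eq_iff.1 hqp.symm)

lemma iUnion_preimage_prefixes {U : Set B.PathSpace} {n : ℕ} (hU : ∀ p ∈ U, cylinder p n ⊆ U) :
    ⋃ v, prefixMap n ⁻¹' prefixes U n v = U := by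
  ext p
  simp only [Set.mem_iUnion, Set.mem_preimage]
  exact ⟨fun ⟨v, hv⟩ => mem_of_prefixMap_mem hU hv, fun hp => ⟨endVertex p n, p, ⟨hp, rfl⟩, rfl⟩⟩

/-- Each prefix in `U` that ends in `w` can be continued inside `U` along each edge that leaves
`w`. -/
lemma sum_F_mul_ncard_prefixes_le [Fintype V] {U : Set B.PathSpace} {n : ℕ}
    (hU : ∀ p ∈ U, cylinder p n ⊆ U) (v : V) :
    ∑ w, B.F v w * (prefixes U n w).ncard ≤ (prefixes U (n + 1) v).ncard := by
  have hex : ∀ (s : Σ w, Fin (B.F v w) × prefixes U n w), ∃ q ∈ U,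
      prefixMap n q = s.2.2 ∧ q.1 (n + 1) = ⟨(s.1, v), s.2.1⟩ := by
    rintro ⟨w, j, t, p, ⟨hp, hpw⟩, rfl⟩
    obtain ⟨q, hq, hqe⟩ := exists_path_through_edge p n ⟨(w, v), j⟩ hpw.symm
    exact ⟨q, hU p hp hq, prefixMap_eq_iff.2 hq, hqe⟩
  choose q hqU hqt hqe using hex
  have hinj : Function.Injective fun s => (⟨prefixMap (n + 1) (q s), q s, ⟨hqU s, by
      rw [endVertex, hqe]; rfl⟩, rfl⟩ : prefixes U (n + 1) v) := by
    intro s s' hs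
    have h1 := prefixMap_eq_iff.1 (Subtype.ext_iff.1 hs)
    have h2 := h1 (n + 1) le_rfl
    have h3 := prefixMap_eq_iff.2 (cylinder_anti _ n.le_succ h1)
    rw [hqe, hqe] at h2
    rw [hqt, hqt] at h3
    obtain ⟨w, j, t⟩ := s
    obtain ⟨w', j', t'⟩ := s'
    obtain ⟨h4, h5⟩ := Sigma.mk.inj_iff.1 h2
    obtain rfl : w = w' := (Prod.ext_iff.1 h4).1
    obtain rfl : j = j' := eq_of_heq h5
    obtain rfl : t = t' := Subtype.ext h3
    rfl
  have := Nat.card_le_card_of_injective _ hinj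
  simpa [Nat.card_sigma, Nat.card_prod, Nat.card_coe_set_eq] using this

section Measure

variable {μ : Measure B.PathSpace} {lam : ℝ} {x : V → ℝ}

lemma IsDefinedBy.real_cylinder (hμ : IsDefinedBy μ lam x) (hx : ∀ i, 0 ≤ x i) (hlam : 0 ≤ lam)
    (p : B.PathSpace) (n : ℕ) : μ.real (cylinder p n) = x (endVertex p n) / lam ^ n := by
  rw [Measure.real, hμ, ENNReal.toReal_ofReal (div_nonneg (hx _) (pow_nonneg hlam n))]

variable [Fintype V] [IsFiniteMeasure μ]

lemma IsDefinedBy.real_preimage (hμ : IsDefinedBy μ lam x) (hx : ∀ i, 0 ≤ x i) (hlam : 0 ≤ lam)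
    {n : ℕ} {v : V} {T : Set ((i : Fin (n + 1)) → B.Edge i)}
    (hT : T ⊆ prefixes Set.univ n v) :
    μ.real (prefixMap n ⁻¹' T) = T.ncard * (x v / lam ^ n) := by
  classical
  have hfin : T.Finite := T.toFinite
  have h1 : prefixMap n ⁻¹' T = ⋃ t ∈ hfin.toFinset, prefixMap n ⁻¹' {t} := by
    ext p
    simp
  rw [h1, measureReal_biUnion_finset]
  · rw [Finset.sum_congr rfl (g := fun _ => x v / lam ^ n), Finset.sum_const, nsmul_eq_mul,
      Set.ncard_eq_toFinset_card T hfin]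
    intro t ht
    obtain ⟨p, ⟨-, hp⟩, rfl⟩ := hT (hfin.mem_toFinset.1 ht)
    rw [← cylinder_eq_preimage, hμ.real_cylinder hx hlam, hp]
  · intro s _ t _ hst
    exact Disjoint.preimage _ (Set.disjoint_singleton.2 hst)
  · exact fun t _ => (isClopen_preimage_prefixMap n _).isOpen.measurableSet

lemma IsDefinedBy.real_iUnion_preimage (hμ : IsDefinedBy μ lam x) (hx : ∀ i, 0 ≤ x i)
    (hlam : 0 ≤ lam) {n : ℕ} {T : V → Set ((i : Fin (n + 1)) → B.Edge i)}
    (hT : ∀ v, T v ⊆ prefixes Set.univ n v) :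
    μ.real (⋃ v, prefixMap n ⁻¹' T v) = ∑ v, (T v).ncard * (x v / lam ^ n) := by
  rw [measureReal_iUnion_fintype]
  · exact Finset.sum_congr rfl fun v _ => hμ.real_preimage hx hlam (hT v)
  · intro v w hvw
    refine Set.disjoint_left.2 fun p hp hp' => hvw ?_
    rw [← endVertex_eq_of_prefixMap_mem (hT v hp), ← endVertex_eq_of_prefixMap_mem (hT w hp')]
  · exact fun v => (isClopen_preimage_prefixMap n _).isOpen.measurableSet

lemma IsDefinedBy.real_eq_sum (hμ : IsDefinedBy μ lam x) (hx : ∀ i, 0 ≤ x i)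
    (hlam : 0 ≤ lam) {n : ℕ} {U : Set B.PathSpace} (hU : ∀ p ∈ U, cylinder p n ⊆ U) :
    μ.real U = ∑ v, (prefixes U n v).ncard * (x v / lam ^ n) := by
  rw [← hμ.real_iUnion_preimage hx hlam fun v => prefixes_subset_univ U n v,
    iUnion_preimage_prefixes hU]

/-- Any numbers of prefixes that do not exceed the numbers available in `U` are those of a clopen
subset of `U`. -/
lemma IsDefinedBy.exists_isClopen_subset (hμ : IsDefinedBy μ lam x) (hx : ∀ i, 0 ≤ x i)
    (hlam : 0 ≤ lam) {n : ℕ} {U : Set B.PathSpace} (hU : ∀ p ∈ U, cylinder p n ⊆ U)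
    (c : V → ℕ) (hc : ∀ v, c v ≤ (prefixes U n v).ncard) :
    ∃ W, IsClopen W ∧ W ⊆ U ∧ μ.real W = ∑ v, c v * (x v / lam ^ n) := by
  choose T hTU hTc using fun v => Set.exists_subset_card_eq (hc v)
  refine ⟨⋃ v, prefixMap n ⁻¹' T v,
    isClopen_iUnion_of_finite fun v => isClopen_preimage_prefixMap n _, ?_, ?_⟩
  · exact (Set.iUnion_mono fun v => Set.preimage_mono (hTU v)).trans
      (iUnion_preimage_prefixes hU).le
  · rw [hμ.real_iUnion_preimage hx hlam fun v => (hTU v).trans (prefixes_subset_univ U n v)]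
    simp only [hTc]

end Measure

end StationaryBratteli

/-! ### Positivity of matrix powers -/

section Matrices

open Matrix

variable {ι : Type*} [Fintype ι]

/-- If `T` has a positive left eigenvector `x` for the eigenvalue `1` and dominates the rank one
matrix `δ 𝟙 xᵀ`, it contracts the `x`-mass of negative parts: the iterates of a vector of positive
`x`-mass become nonnegative. -/
lemma exists_pow_mulVec_nonneg_of_doeblin [DecidableEq ι] {T : Matrix ι ι ℝ} {x : ι → ℝ}
    (hx : ∀ i, 0 < x i) (hT : x ᵥ* T = x) {δ : ℝ} (hδ : 0 < δ) (hTx : ∀ i j, δ * x j ≤ T i j)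
    {w : ι → ℝ} (hw : 0 < x ⬝ᵥ w) : ∃ k : ℕ, ∀ i, 0 ≤ ((T ^ k) *ᵥ w) i := by
  classical
  have hT0 : ∀ i j, 0 ≤ T i j := fun i j => (mul_nonneg hδ.le (hx j).le).trans (hTx i j)
  have hcol : ∀ j, ∑ i, x i * T i j = x j := fun j => congrFun hT j
  -- the mass of the negative part
  set N : (ι → ℝ) → ℝ := fun u => ∑ j, x j * max (-u j) 0 with hN
  have hneg : ∀ (u : ι → ℝ) i, x ⬝ᵥ u = x ⬝ᵥ w →
      δ * (x ⬝ᵥ w) - ∑ j, (T i j - δ * x j) * max (-u j) 0 ≤ (T *ᵥ u) i := by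
    intro u i hu
    rw [← hu, dotProduct, mulVec, dotProduct, Finset.mul_sum, ← Finset.sum_sub_distrib]
    refine Finset.sum_le_sum fun j _ => ?_
    have h1 : -u j ≤ max (-u j) 0 := le_max_left _ _
    nlinarith [mul_le_mul_of_nonneg_left h1 (sub_nonneg.2 (hTx i j))]
  have hmass : ∀ u, x ⬝ᵥ (T *ᵥ u) = x ⬝ᵥ u := fun u => by rw [dotProduct_mulVec, hT]
  have hmassk : ∀ k : ℕ, x ⬝ᵥ ((T ^ k) *ᵥ w) = x ⬝ᵥ w := by
    intro k
    induction k with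
    | zero => simp
    | succ k ih => rw [pow_succ', ← mulVec_mulVec, hmass, ih]
  set r : ℝ := 1 - δ * ∑ i, x i with hr
  have hcontr : ∀ u, x ⬝ᵥ u = x ⬝ᵥ w → N (T *ᵥ u) ≤ r * N u := by
    intro u hu
    have h1 : ∀ i, max (-(T *ᵥ u) i) 0 ≤ ∑ j, (T i j - δ * x j) * max (-u j) 0 := by
      intro i
      refine max_le ?_ (Finset.sum_nonneg fun j _ =>
        mul_nonneg (sub_nonneg.2 (hTx i j)) (le_max_right _ _))
      nlinarith [hneg u i hu, mul_pos hδ hw]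
    calc N (T *ᵥ u) ≤ ∑ i, x i * ∑ j, (T i j - δ * x j) * max (-u j) 0 :=
          Finset.sum_le_sum fun i _ => mul_le_mul_of_nonneg_left (h1 i) (hx i).le
      _ = ∑ j, (∑ i, x i * (T i j - δ * x j)) * max (-u j) 0 := by
          simp only [Finset.mul_sum, Finset.sum_mul]
          rw [Finset.sum_comm]
          simp only [mul_assoc]
      _ = r * N u := by
          rw [hN, Finset.mul_sum]
          refine Finset.sum_congr rfl fun j _ => ?_
          simp only [mul_sub, Finset.sum_sub_distrib, hcol, ← Finset.sum_mul, hr]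
          ring
  rcases isEmpty_or_nonempty ι with he | ⟨⟨i₀⟩⟩
  · exact ⟨0, fun i => he.elim i⟩
  have hN0 : ∀ u, 0 ≤ N u := fun u =>
    Finset.sum_nonneg fun j _ => mul_nonneg (hx j).le (le_max_right _ _)
  have hr0 : 0 ≤ r := by
    have h1 := Finset.sum_le_sum fun i (_ : i ∈ Finset.univ) =>
      mul_le_mul_of_nonneg_left (hTx i i₀) (hx i).le
    rw [hcol, ← Finset.sum_mul] at h1
    have h2 := hx i₀
    rw [hr]
    by_contra! h3
    nlinarith
  have hr1 : r < 1 := by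
    have : 0 < ∑ i, x i := Finset.sum_pos (fun i _ => hx i) ⟨i₀, Finset.mem_univ _⟩
    nlinarith [mul_pos hδ this]
  have hNk : ∀ k : ℕ, N ((T ^ k) *ᵥ w) ≤ r ^ k * N w := by
    intro k
    induction k with
    | zero => simp
    | succ k ih =>
      rw [pow_succ', ← mulVec_mulVec, pow_succ', mul_assoc]
      exact (hcontr _ (hmassk k)).trans (mul_le_mul_of_nonneg_left ih hr0)
  have hlim : Filter.Tendsto (fun k : ℕ => r ^ k * N w) Filter.atTop (nhds 0) := by
    simpa using (tendsto_pow_atTop_nhds_zero_of_lt_one hr0 hr1).mul_const (N w)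
  have hev : ∀ᶠ k : ℕ in Filter.atTop, ∀ i, r ^ k * N w < x i * (δ * (x ⬝ᵥ w)) :=
    Filter.eventually_all.2 fun i =>
      hlim.eventually_lt_const (mul_pos (hx i) (mul_pos hδ hw))
  obtain ⟨k, hk⟩ := hev.exists
  refine ⟨k + 1, fun i => ?_⟩
  rw [pow_succ', ← mulVec_mulVec]
  refine le_trans (sub_nonneg.2 ?_) (hneg _ i (hmassk k))
  set u := (T ^ k) *ᵥ w
  -- `x i * T i j ≤ x j` because `x` is a left eigenvector
  have h1 : x i * ∑ j, (T i j - δ * x j) * max (-u j) 0 ≤ N u := by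
    rw [Finset.mul_sum]
    refine Finset.sum_le_sum fun j _ => ?_
    rw [← mul_assoc]
    refine mul_le_mul_of_nonneg_right ?_ (le_max_right _ _)
    have h2 : x i * T i j ≤ x j := by
      rw [← hcol j]
      exact Finset.single_le_sum (f := fun i => x i * T i j)
        (fun i _ => mul_nonneg (hx i).le (hT0 i j)) (Finset.mem_univ i)
    nlinarith [mul_pos (hx i) (mul_pos hδ (hx j))]
  exact le_of_mul_le_mul_left ((h1.trans (hNk k)).trans (hk i).le) (hx i)

/-- A primitive nonnegative integer matrix with a positive left eigenvector `x` has, for every vector of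
positive `x`-mass, a power that maps it to a nonnegative vector. -/
lemma exists_pow_mulVec_nonneg [DecidableEq ι] {Q : Matrix ι ι ℕ} {M : ℕ}
    (hQ : ∀ i j, 0 < (Q ^ M) i j) {x : ι → ℝ} (hx : ∀ i, 0 < x i) {lam : ℝ} (hlam : 0 < lam)
    (hxQ : x ᵥ* Q.map (Nat.cast : ℕ → ℝ) = lam • x) {z : ι → ℤ} (hz : 0 < ∑ i, x i * z i) :
    ∃ k : ℕ, ∀ i, 0 ≤ ((Q.map (Nat.cast : ℕ → ℤ)) ^ k *ᵥ z) i := by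
  classical
  set R : Matrix ι ι ℝ := Q.map (Nat.cast : ℕ → ℝ)
  have hcast : ∀ k, R ^ k = (Q ^ k).map (Nat.cast : ℕ → ℝ) := fun k =>
    ((Nat.castRingHom ℝ).mapMatrix.map_pow Q k).symm
  have hcastZ : ∀ k i, ((((Q.map (Nat.cast : ℕ → ℤ)) ^ k *ᵥ z) i : ℤ) : ℝ) =
      (R ^ k *ᵥ fun i => (z i : ℝ)) i := by
    intro k i
    have h1 : (Q.map (Nat.cast : ℕ → ℤ)) ^ k = (Q ^ k).map (Nat.cast : ℕ → ℤ) :=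
      ((Nat.castRingHom ℤ).mapMatrix.map_pow Q k).symm
    rw [h1, hcast]
    simp [mulVec, dotProduct]
  have hxk : ∀ k : ℕ, x ᵥ* R ^ k = lam ^ k • x := by
    intro k
    induction k with
    | zero => simp
    | succ k ih => rw [pow_succ', ← vecMul_vecMul, hxQ, smul_vecMul, ih, smul_smul, pow_succ']
  have hpos : 0 < lam ^ M := pow_pos hlam M
  set T : Matrix ι ι ℝ := (lam ^ M)⁻¹ • R ^ M with hTdef
  rcases isEmpty_or_nonempty ι with he | ⟨⟨i₀⟩⟩
  · exact ⟨0, fun i => he.elim i⟩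
  have hsum : 0 < ∑ i, x i := Finset.sum_pos (fun i _ => hx i) ⟨i₀, Finset.mem_univ _⟩
  -- the entries of `Q ^ M` are at least `1`, and `x j / ∑ i, x i ≤ 1`
  obtain ⟨k, hk⟩ := exists_pow_mulVec_nonneg_of_doeblin (T := T) hx
    (by rw [hTdef, vecMul_smul, hxk, smul_smul, inv_mul_cancel₀ hpos.ne', one_smul])
    (δ := (lam ^ M)⁻¹ * (∑ i, x i)⁻¹) (by positivity) (by
      intro i j
      rw [hTdef, Matrix.smul_apply, smul_eq_mul, mul_assoc]
      refine mul_le_mul_of_nonneg_left ?_ (by positivity)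
      rw [inv_mul_le_iff₀ hsum, hcast, map_apply]
      have h1 : x j ≤ ∑ i, x i :=
        Finset.single_le_sum (fun i _ => (hx i).le) (Finset.mem_univ j)
      have h2 : (1 : ℝ) ≤ ((Q ^ M) i j : ℕ) := by exact_mod_cast hQ i j
      nlinarith) (w := fun i => (z i : ℝ)) hz
  refine ⟨M * k, fun i => ?_⟩
  have h1 := hk i
  rw [hTdef, smul_pow, smul_mulVec, Pi.smul_apply, smul_eq_mul, ← pow_mul, ← hcastZ] at h1
  have h2 : (0 : ℝ) < ((lam ^ M)⁻¹) ^ k := by positivity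
  exact_mod_cast nonneg_of_mul_nonneg_right h1 h2

lemma natMatrix_mul_pos {A C : Matrix ι ι ℕ} {i j : ι} (k : ι) (h1 : 0 < A i k)
    (h2 : 0 < C k j) : 0 < (A * C) i j := by
  rw [mul_apply]
  exact Finset.sum_pos' (fun _ _ => Nat.zero_le _) ⟨k, Finset.mem_univ k, Nat.mul_pos h1 h2⟩

/-- A matrix over `ℕ` is primitive if it is irreducible, has no zero column, and any two indices
can be driven to a common one in the same number of steps. -/
lemma exists_pow_pos_of_coalescing [DecidableEq ι] {Q : Matrix ι ι ℕ}
    (hirr : ∀ c d, ∃ m, 0 < (Q ^ m) d c) (hcol : ∀ a, ∃ c, 0 < Q c a)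
    (hcoal : ∀ a b, ∃ n c, 0 < (Q ^ n) c a ∧ 0 < (Q ^ n) c b) :
    ∃ M, ∀ i j, 0 < (Q ^ M) i j := by
  rcases isEmpty_or_nonempty ι with he | ⟨⟨i₀⟩⟩
  · exact ⟨0, fun i => he.elim i⟩
  have hcolk : ∀ (k : ℕ) a, ∃ c, 0 < (Q ^ k) c a := by
    intro k
    induction k with
    | zero => exact fun a => ⟨a, by simp⟩
    | succ k ih =>
      intro a
      obtain ⟨b, hb⟩ := hcol a
      obtain ⟨c, hc⟩ := ih b
      exact ⟨c, by rw [pow_succ]; exact natMatrix_mul_pos b hc hb⟩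
  -- all indices are driven to a common one
  have hall : ∀ s : Finset ι, ∃ n c, ∀ a ∈ s, 0 < (Q ^ n) c a := by
    intro s
    induction s using Finset.induction_on with
    | empty => exact ⟨0, i₀, by simp⟩
    | insert b s _ ih =>
      obtain ⟨n, c, h⟩ := ih
      obtain ⟨d, hd⟩ := hcolk n b
      obtain ⟨m, e, hec, hed⟩ := hcoal c d
      refine ⟨m + n, e, fun a ha => ?_⟩
      rw [pow_add]
      rcases Finset.mem_insert.1 ha with rfl | ha
      · exact natMatrix_mul_pos d hed hd
      · exact natMatrix_mul_pos c hec (h a ha)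
  obtain ⟨n, c, hc⟩ := hall Finset.univ
  have hc' : ∀ k a, 0 < (Q ^ (n + k)) c a := by
    intro k a
    obtain ⟨b, hb⟩ := hcolk k a
    rw [pow_add]
    exact natMatrix_mul_pos b (hc b (Finset.mem_univ b)) hb
  choose m hm using hirr c
  refine ⟨Finset.univ.sup m + n, fun i j => ?_⟩
  have h1 : m i ≤ Finset.univ.sup m := Finset.le_sup (Finset.mem_univ i)
  rw [show Finset.univ.sup m + n = m i + (n + (Finset.univ.sup m - m i)) by omega, pow_add]
  exact natMatrix_mul_pos c (hm i) (hc' _ j)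

end Matrices

namespace StationaryBratteli

variable {V : Type*} {B : StationaryBratteli V}

/-! ### The vertices charged by the eigenvector -/

lemma IsClass.nonempty {α : Finset V} (hα : B.IsClass α) : α.Nonempty := by
  obtain ⟨a, -, h⟩ := hα
  exact ⟨a, (h a).2 ⟨.refl, .refl⟩⟩

lemma IsClass.reach {α : Finset V} (hα : B.IsClass α) {v w : V} (hv : v ∈ α) (hw : w ∈ α) :
    B.Reach v w := by
  obtain ⟨a, -, h⟩ := hα
  exact ((h v).1 hv).2.trans ((h w).1 hw).1

lemma IsClass.mem_of_reach {α : Finset V} (hα : B.IsClass α) {u v w : V} (hu : u ∈ α)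
    (hw : w ∈ α) (huv : B.Reach u v) (hvw : B.Reach v w) : v ∈ α := by
  obtain ⟨a, -, h⟩ := hα
  exact (h v).2 ⟨((h u).1 hu).1.trans huv, hvw.trans ((h w).1 hw).2⟩

variable [Fintype V]

lemma mem_accessible {α : Finset V} {i : V} : i ∈ B.accessible α ↔ ∃ a ∈ α, B.Reach i a := by
  classical
  simp [accessible]

namespace IsEigenvectorOf

variable {α : Finset V} {lam : ℝ} {x : V → ℝ}

lemma sum_eq (hx : B.IsEigenvectorOf α lam x) (w : V) :
    ∑ v, (B.F v w : ℝ) * x v = lam * x w := by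
  simpa [Matrix.mulVec, dotProduct] using congrFun hx.eigen w

lemma mem_accessible_of_ne_zero (hx : B.IsEigenvectorOf α lam x) {v : V} (hv : x v ≠ 0) :
    v ∈ B.accessible α :=
  by_contra fun h => hv (hx.zero_off v h)

lemma ne_zero_of_edge (hx : B.IsEigenvectorOf α lam x) {v w : V} (hF : B.F v w ≠ 0)
    (hv : x v ≠ 0) : x w ≠ 0 := by
  intro hw
  have h1 := hx.sum_eq w
  rw [hw, mul_zero, Finset.sum_eq_zero_iff_of_nonneg
    fun v _ => mul_nonneg (Nat.cast_nonneg _) (hx.nonneg v)] at h1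
  exact mul_ne_zero (Nat.cast_ne_zero.2 hF) hv (h1 v (Finset.mem_univ v))

lemma ne_zero_of_reach (hx : B.IsEigenvectorOf α lam x) {v w : V} (hr : B.Reach w v)
    (hv : x v ≠ 0) : x w ≠ 0 := by
  induction hr using Relation.ReflTransGen.head_induction_on with
  | refl => exact hv
  | head h _ ih => exact hx.ne_zero_of_edge h ih

lemma exists_ne_zero (hx : B.IsEigenvectorOf α lam x) : ∃ v, x v ≠ 0 := by
  by_contra! h
  have := hx.normalised
  simp [h] at this

lemma pos_of_nonneg (hx : B.IsEigenvectorOf α lam x) (hlam : 0 ≤ lam) : 0 < lam := by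
  refine lt_of_le_of_ne hlam fun h0 => ?_
  obtain ⟨v, hv⟩ := hx.exists_ne_zero
  obtain ⟨w, hw⟩ := B.row_ne v
  have h1 := hx.sum_eq w
  rw [← h0, zero_mul, Finset.sum_eq_zero_iff_of_nonneg
    fun v _ => mul_nonneg (Nat.cast_nonneg _) (hx.nonneg v)] at h1
  exact mul_ne_zero (Nat.cast_ne_zero.2 hw) hv (h1 v (Finset.mem_univ v))

lemma exists_edge_ne_zero (hx : B.IsEigenvectorOf α lam x) (hlam : 0 < lam) {w : V}
    (hw : x w ≠ 0) : ∃ v, B.F v w ≠ 0 ∧ x v ≠ 0 := by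
  by_contra! h
  have h1 := hx.sum_eq w
  rw [Finset.sum_eq_zero fun v _ => ?_] at h1
  · exact mul_ne_zero hlam.ne' hw h1.symm
  · by_cases hF : B.F v w = 0
    · simp [hF]
    · simp [h v hF]

/-- The restriction of the eigenvector to a set `β` that no edge leaves towards a charged vertex
outside `β` is a left eigenvector of the diagonal block of `β`. -/
lemma sum_block_eq (hx : B.IsEigenvectorOf α lam x) {β : Finset V}
    (hβ : ∀ w ∈ β, ∀ v, B.F v w ≠ 0 → x v ≠ 0 → v ∈ β) (w : β) :
    ∑ v : β, x v * (B.F v w : ℝ) = lam * x w := by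
  rw [← hx.sum_eq, Finset.sum_coe_sort β fun v => x v * (B.F v w : ℝ)]
  simp only [mul_comm (x _)]
  refine Finset.sum_subset (Finset.subset_univ _) fun v _ hv => ?_
  by_contra h
  exact hv (hβ w w.2 v (fun h0 => h (by simp [h0])) (fun h0 => h (by simp [h0])))

lemma mem_of_edge (hx : B.IsEigenvectorOf α lam x) (hα : B.IsClass α) {v w : V} (hw : w ∈ α)
    (hF : B.F v w ≠ 0) (hv : x v ≠ 0) : v ∈ α := by
  obtain ⟨a, ha, hva⟩ := mem_accessible.1 (hx.mem_accessible_of_ne_zero hv)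
  exact hα.mem_of_reach hw ha (.single hF) hva

/-- A path that has entered the class `α` can leave it only towards vertices of weight zero. -/
lemma endVertex_mem (hx : B.IsEigenvectorOf α lam x) (hα : B.IsClass α) {p : B.PathSpace}
    {m n : ℕ} (hmn : m ≤ n) (hm : endVertex p m ∈ α) (hn : x (endVertex p n) ≠ 0) :
    endVertex p n ∈ α := by
  induction n, hmn using Nat.le_induction with
  | base => exact hm
  | succ n _ ih =>
    have hF := F_endVertex_ne_zero p n
    exact hx.mem_of_edge hα (ih (hx.ne_zero_of_edge hF hn)) hF hn

variable [DecidableEq V]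

lemma le_rho (hx : B.IsEigenvectorOf α lam x) (hlam : 0 ≤ lam) {β : Finset V}
    (hβ : ∀ w ∈ β, ∀ v, B.F v w ≠ 0 → x v ≠ 0 → v ∈ β) {i : V} (hi : i ∈ β) (hxi : x i ≠ 0) :
    lam ≤ B.rho β := by
  set M : Matrix β β ℂ := Matrix.of fun v w : β => (B.F v w : ℂ) with hM
  have hmem : (lam : ℂ) ∈ spectrum ℂ M := by
    rw [spectrum.mem_iff, Matrix.isUnit_iff_isUnit_det, isUnit_iff_ne_zero, not_not]
    refine Matrix.exists_vecMul_eq_zero_iff.1 ⟨fun v => (x v : ℂ), fun h => hxi ?_, ?_⟩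
    · simpa using congrFun h ⟨i, hi⟩
    · rw [Matrix.vecMul_sub, sub_eq_zero, Algebra.algebraMap_eq_smul_one, Matrix.vecMul_smul,
        Matrix.vecMul_one]
      funext w
      have := congrArg (fun t : ℝ => (t : ℂ)) (hx.sum_block_eq hβ w)
      push_cast at this
      simpa [Matrix.vecMul, dotProduct, hM] using this.symm
  have hle : (‖(lam : ℂ)‖₊ : ENNReal) ≤ spectralRadius ℂ M :=
    le_iSup₂ (f := fun k (_ : k ∈ spectrum ℂ M) => (‖k‖₊ : ENNReal)) _ hmem
  have hfin : spectralRadius ℂ M ≠ ⊤ := by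
    have h := (Matrix.finite_spectrum M).image (fun k => ‖k‖₊)
    obtain ⟨C, hC⟩ := h.bddAbove
    refine ne_top_of_le_ne_top (ENNReal.coe_ne_top (r := C)) (iSup₂_le fun k hk => ?_)
    exact ENNReal.coe_le_coe.2 (hC ⟨k, hk, rfl⟩)
  have h2 := ENNReal.toReal_mono hfin hle
  rwa [ENNReal.coe_toReal, coe_nnnorm, Complex.norm_real, Real.norm_of_nonneg hlam] at h2

/-- The eigenvector cannot be carried by the classes below the distinguished class `α`: a class
that is terminal in its support would have a spectral radius of at least `lam`. -/
lemma exists_mem_ne_zero (hx : B.IsEigenvectorOf α lam x) (hα : B.IsDistinguishedClass α)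
    (hlam : 0 < lam) (hrho : lam = B.rho α) : ∃ a ∈ α, x a ≠ 0 := by
  classical
  by_contra! hzero
  let f : V → ℕ := fun i => (Finset.univ.filter fun j => x j ≠ 0 ∧ B.Reach i j).card
  obtain ⟨i₀, hi₀⟩ := hx.exists_ne_zero
  obtain ⟨i, hi, hmin⟩ := (Finset.univ.filter fun i => x i ≠ 0).exists_min_image f
    ⟨i₀, by simpa using hi₀⟩
  replace hi : x i ≠ 0 := by simpa using hi
  -- minimality of the forward orbit makes reachability from `i` symmetric
  have hsymm : ∀ j, x j ≠ 0 → B.Reach i j → B.Reach j i := by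
    intro j hj hij
    have hsub : (Finset.univ.filter fun k => x k ≠ 0 ∧ B.Reach j k) ⊆
        Finset.univ.filter fun k => x k ≠ 0 ∧ B.Reach i k := by
      intro k hk
      simp only [Finset.mem_filter, Finset.mem_univ, true_and] at hk ⊢
      exact ⟨hk.1, hij.trans hk.2⟩
    have heq := Finset.eq_of_subset_of_card_le hsub (hmin j (by simpa using hj))
    have : i ∈ Finset.univ.filter fun k => x k ≠ 0 ∧ B.Reach i k := by
      simpa using ⟨hi, Relation.ReflTransGen.refl⟩
    rw [← heq] at this
    exact (Finset.mem_filter.1 this).2.2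
  let β : Finset V := Finset.univ.filter fun v => B.Reach i v ∧ B.Reach v i
  have hβ : ∀ v, v ∈ β ↔ B.Reach i v ∧ B.Reach v i := by simp [β]
  have hiβ : i ∈ β := (hβ i).2 ⟨.refl, .refl⟩
  have hβx : ∀ v ∈ β, x v ≠ 0 := fun v hv => hx.ne_zero_of_reach ((hβ v).1 hv).2 hi
  obtain ⟨j, hij, hj⟩ := hx.exists_edge_ne_zero hlam hi
  have hclass : B.IsClass β :=
    ⟨i, Relation.TransGen.head' hij (hsymm j hj (.single hij)), hβ⟩
  have hlt := hα.2 β hclass (by rintro rfl; exact hi (hzero i hiβ))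
    fun v hv => hx.mem_accessible_of_ne_zero (hβx v hv)
  refine absurd (hx.le_rho hlam.le (β := β) (fun w hw v hF hv => ?_) hiβ hi)
    (not_le.2 (hrho ▸ hlt))
  have h1 : B.Reach i v := ((hβ w).1 hw).1.tail hF
  exact (hβ v).2 ⟨h1, hsymm v hv h1⟩

lemma ne_zero_iff (hx : B.IsEigenvectorOf α lam x) (hα : B.IsDistinguishedClass α)
    (hlam : 0 < lam) (hrho : lam = B.rho α) {i : V} : x i ≠ 0 ↔ i ∈ B.accessible α := by
  refine ⟨hx.mem_accessible_of_ne_zero, fun h => ?_⟩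
  obtain ⟨b, hb, hib⟩ := mem_accessible.1 h
  obtain ⟨a, ha, hxa⟩ := hx.exists_mem_ne_zero hα hlam hrho
  exact hx.ne_zero_of_reach (hib.trans (hα.1.reach hb ha)) hxa

end IsEigenvectorOf

end StationaryBratteli

namespace StationaryBratteli

variable {V : Type*} {B : StationaryBratteli V}

/-! ### Consequences of ergodicity -/

/-- The paths that eventually run through the prescribed sets of vertices. -/
def tailSet (s : ℕ → Set V) : Set B.PathSpace := {p | ∃ N, ∀ n ≥ N, endVertex p n ∈ s n}

lemma measurableSet_tailSet (s : ℕ → Set V) : MeasurableSet (tailSet (B := B) s) := by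
  have : tailSet (B := B) s = ⋃ N, ⋂ n ≥ N, {p : B.PathSpace | endVertex p n ∈ s n} := by
    ext p
    simp [tailSet]
  rw [this]
  exact .iUnion fun N => .iInter fun n => .iInter fun _ =>
    (isClopen_endVertex_mem (s n) n).isOpen.measurableSet

lemma TailEquiv.symm {p q : B.PathSpace} (h : TailEquiv p q) : TailEquiv q p :=
  let ⟨N, hN⟩ := h
  ⟨N, fun n hn => (hN n hn).symm⟩

lemma TailEquiv.mem_tailSet {s : ℕ → Set V} {p q : B.PathSpace} (h : TailEquiv p q)
    (hp : p ∈ tailSet s) : q ∈ tailSet s := by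
  obtain ⟨N, hN⟩ := h
  obtain ⟨M, hM⟩ := hp
  refine ⟨max M N, fun n hn => ?_⟩
  rw [← endVertex_congr (hN n ((le_max_right M N).trans hn))]
  exact hM n ((le_max_left M N).trans hn)

lemma IsTailErgodic.tailSet_zero_one {μ : Measure B.PathSpace} (herg : IsTailErgodic μ)
    (s : ℕ → Set V) : μ (tailSet s) = 0 ∨ μ (tailSet s)ᶜ = 0 :=
  herg _ (measurableSet_tailSet s) fun _ _ h => ⟨h.mem_tailSet, h.symm.mem_tailSet⟩

/-- The block of the incidence matrix that belongs to a set of vertices. -/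
def block (B : StationaryBratteli V) (α : Finset V) : Matrix α α ℕ :=
  Matrix.of fun v w => B.F v w

lemma block_pow_endVertex_pos [DecidableEq V] {α : Finset V} {p : B.PathSpace}
    (hp : ∀ n, endVertex p n ∈ α) (n : ℕ) :
    0 < (B.block α ^ n) ⟨endVertex p n, hp n⟩ ⟨endVertex p 0, hp 0⟩ := by
  induction n with
  | zero => simp
  | succ n ih =>
    rw [pow_succ']
    exact natMatrix_mul_pos ⟨endVertex p n, hp n⟩
      (Nat.pos_of_ne_zero (F_endVertex_ne_zero p n)) ih

variable {μ : Measure B.PathSpace} [IsProbabilityMeasure μ] {lam : ℝ} {x : V → ℝ}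

lemma IsDefinedBy.measure_start_ne_zero (hμ : IsDefinedBy μ lam x) {a : V} (ha : 0 < x a) :
    μ {p | endVertex p 0 = a} ≠ 0 := by
  obtain ⟨p₀⟩ := nonempty_of_isProbabilityMeasure μ
  obtain ⟨q, rfl⟩ := exists_endVertex_zero_eq p₀ a
  refine ne_bot_of_le_ne_bot ?_ (measure_mono (s := cylinder q 0)
    fun p hp => endVertex_eq_of_mem_cylinder hp)
  rw [hμ, pow_zero, div_one]
  exact (ENNReal.ofReal_pos.2 ha).ne'

variable [Fintype V]

lemma IsDefinedBy.ae_endVertex_ne_zero (hμ : IsDefinedBy μ lam x) (hx : ∀ i, 0 ≤ x i)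
    (hlam : 0 ≤ lam) : ∀ᵐ p ∂μ, ∀ n, x (endVertex p n) ≠ 0 := by
  refine ae_all_iff.2 fun n => ?_
  have h1 : μ.real {p : B.PathSpace | endVertex p n ∈ {v | x v = 0}} = 0 := by
    rw [hμ.real_eq_sum hx hlam (n := n) fun p hp q hq => ?_]
    · refine Finset.sum_eq_zero fun v _ => ?_
      by_cases hv : x v = 0
      · simp [hv]
      · suffices h : prefixes {p : B.PathSpace | endVertex p n ∈ {v | x v = 0}} n v = ∅ by
          rw [h, Set.ncard_empty, Nat.cast_zero, zero_mul]
        rw [prefixes, Set.image_eq_empty, Set.eq_empty_iff_forall_notMem]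
        rintro p ⟨hp, rfl⟩
        exact hv hp
    · simp only [Set.mem_ofPred_eq] at hp ⊢
      rwa [endVertex_eq_of_mem_cylinder hq]
  simpa [ae_iff] using (measureReal_eq_zero_iff).1 h1

/-- A tail event that contains almost every path starting at a charged vertex `a` is almost
sure. -/
lemma IsDefinedBy.ae_mem_tailSet (hμ : IsDefinedBy μ lam x) (hx : ∀ i, 0 ≤ x i)
    (hlam : 0 ≤ lam) (herg : IsTailErgodic μ) {a : V} (ha : 0 < x a) {s : ℕ → Set V}
    (hs : ∀ p : B.PathSpace, endVertex p 0 = a → (∀ n, x (endVertex p n) ≠ 0) →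
      ∀ n, endVertex p n ∈ s n) : ∀ᵐ p ∂μ, p ∈ tailSet s := by
  refine (herg.tailSet_zero_one s).resolve_left fun h => hμ.measure_start_ne_zero ha ?_
  refine measure_mono_null_ae ?_ h
  filter_upwards [hμ.ae_endVertex_ne_zero hx hlam] with p hp hpa
  exact ⟨0, fun n _ => hs p hpa hp n⟩

variable {α : Finset V}

/-- Almost every path ends up in the class `α`. -/
lemma IsEigenvectorOf.ae_mem_tailSet_class (hx : B.IsEigenvectorOf α lam x) (hα : B.IsClass α)
    (hpos : ∀ a ∈ α, 0 < x a) (hlam : 0 < lam) (hμ : IsDefinedBy μ lam x)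
    (herg : IsTailErgodic μ) : ∀ᵐ p ∂μ, p ∈ tailSet fun _ => (α : Set V) := by
  obtain ⟨a, ha⟩ := hα.nonempty
  refine hμ.ae_mem_tailSet hx.nonneg hlam.le herg (hpos a ha) fun p hp hp' n => ?_
  exact hx.endVertex_mem hα n.zero_le (hp ▸ ha) (hp' n)

/-- The part of a set that has not yet entered the class `α` loses its mass. -/
lemma IsEigenvectorOf.eventually_lt_real (hx : B.IsEigenvectorOf α lam x) (hα : B.IsClass α)
    (hpos : ∀ a ∈ α, 0 < x a) (hlam : 0 < lam) (hμ : IsDefinedBy μ lam x)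
    (herg : IsTailErgodic μ) (U : Set B.PathSpace) {t : ℝ} (ht : t < μ.real U) :
    ∀ᶠ N in Filter.atTop, t < μ.real (U ∩ {p | endVertex p N ∈ (α : Set V)}) := by
  let E : ℕ → Set B.PathSpace := fun N => U ∩ {p | ∀ n ≥ N, endVertex p n ∈ (α : Set V)}
  have hmono : Monotone E := fun M N hMN =>
    Set.inter_subset_inter_right _ fun p hp n hn => hp n (hMN.trans hn)
  have hU : μ (⋃ N, E N) = μ U := by
    rw [← Set.inter_iUnion]
    refine measure_inter_conull ?_
    rw [show (⋃ N, {p : B.PathSpace | ∀ n ≥ N, endVertex p n ∈ (α : Set V)}) =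
      tailSet fun _ => (α : Set V) by ext p; simp [tailSet]]
    exact hx.ae_mem_tailSet_class hα hpos hlam hμ herg
  have hlim := tendsto_measure_iUnion_atTop (μ := μ) hmono
  rw [hU] at hlim
  have hlim' := (ENNReal.tendsto_toReal (measure_ne_top μ U)).comp hlim
  filter_upwards [hlim'.eventually_const_lt ht] with N hN
  exact hN.trans_le (measureReal_mono (Set.inter_subset_inter_right _ fun p hp => hp N le_rfl))

/-- The diagonal block of `α` is primitive. If two vertices could never be driven to a common one
in equally many steps, then the paths that eventually run through the forward orbit of the first
vertex would form a tail event that is neither null nor conull. -/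
lemma IsEigenvectorOf.exists_block_pow_pos [DecidableEq V] (hx : B.IsEigenvectorOf α lam x)
    (hα : B.IsClass α) (hpos : ∀ a ∈ α, 0 < x a) (hlam : 0 < lam) (hμ : IsDefinedBy μ lam x)
    (herg : IsTailErgodic μ) : ∃ M, ∀ i j, 0 < (B.block α ^ M) i j := by
  refine exists_pow_pos_of_coalescing ?_ ?_ ?_
  · intro c d
    have h : ∀ v, B.Reach c v → ∀ hv : v ∈ α, ∃ m, 0 < (B.block α ^ m) ⟨v, hv⟩ c := by
      intro v hv
      induction hv with
      | refl => exact fun _ => ⟨0, by simp⟩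
      | @tail w v hcw hwv ih =>
        intro hv
        have hw := hα.mem_of_reach c.2 hv hcw (.single hwv)
        obtain ⟨m, hm⟩ := ih hw
        refine ⟨m + 1, ?_⟩
        rw [pow_succ']
        exact natMatrix_mul_pos ⟨w, hw⟩ (Nat.pos_of_ne_zero hwv) hm
    exact h d (hα.reach c.2 d.2) d.2
  · intro a
    obtain ⟨v, hF, hv⟩ := hx.exists_edge_ne_zero hlam (hpos a a.2).ne'
    exact ⟨⟨v, hx.mem_of_edge hα a.2 hF hv⟩, Nat.pos_of_ne_zero hF⟩
  · intro a b
    -- `orbit c n` is the set of vertices of `α` reached from `c` inside `α` in `n` steps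
    let orbit : α → ℕ → Set V := fun c n => {v | ∃ hv : v ∈ α, 0 < (B.block α ^ n) ⟨v, hv⟩ c}
    have h : ∀ c : α, ∀ᵐ p ∂μ, p ∈ tailSet (orbit c) := by
      intro c
      refine hμ.ae_mem_tailSet hx.nonneg hlam.le herg (hpos c c.2) fun p hp hp' n => ?_
      have hmem : ∀ n, endVertex p n ∈ α := fun n =>
        hx.endVertex_mem hα n.zero_le (hp ▸ c.2) (hp' n)
      have hc : c = ⟨endVertex p 0, hmem 0⟩ := Subtype.ext hp.symm
      rw [hc]
      exact ⟨hmem n, block_pow_endVertex_pos hmem n⟩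
    obtain ⟨p, ⟨N, hN⟩, M, hM⟩ := ((h a).and (h b)).exists
    obtain ⟨hv, h1⟩ := hN (max N M) (le_max_left _ _)
    obtain ⟨_, h2⟩ := hM (max N M) (le_max_right _ _)
    exact ⟨max N M, ⟨_, hv⟩, h1, h2⟩

end StationaryBratteli

/-! ### The criterion for goodness -/

lemma mem_closure_image_iff {V : Type*} {α : Finset V} {x : V → ℝ} {g : ℝ} :
    g ∈ AddSubgroup.closure (x '' (α : Set V)) ↔ ∃ z : α → ℤ, ∑ a : α, x a * z a = g := by
  classical
  constructor
  · intro h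
    induction h using AddSubgroup.closure_induction with
    | mem g hg =>
      obtain ⟨a, ha, rfl⟩ := hg
      exact ⟨Pi.single ⟨a, ha⟩ 1, by simp [Pi.single_apply]⟩
    | zero => exact ⟨0, by simp⟩
    | add g g' _ _ h h' =>
      obtain ⟨z, rfl⟩ := h
      obtain ⟨z', rfl⟩ := h'
      exact ⟨z + z', by simp [mul_add, Finset.sum_add_distrib]⟩
    | neg g _ h =>
      obtain ⟨z, rfl⟩ := h
      exact ⟨-z, by simp⟩
  · rintro ⟨z, rfl⟩
    refine AddSubgroup.sum_mem _ fun a _ => ?_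
    rw [mul_comm, ← zsmul_eq_mul]
    exact AddSubgroup.zsmul_mem _ (AddSubgroup.subset_closure (Set.mem_image_of_mem x a.2)) _

namespace StationaryBratteli

open Matrix

variable {V : Type*} {B : StationaryBratteli V}

lemma forall_cylinder_subset_inter {U : Set B.PathSpace} {n : ℕ}
    (hU : ∀ p ∈ U, cylinder p n ⊆ U) (s : Set V) :
    ∀ p ∈ U ∩ {p | endVertex p n ∈ s}, cylinder p n ⊆ U ∩ {p | endVertex p n ∈ s} := by
  rintro p ⟨hp, hps⟩ q hq
  refine ⟨hU p hp hq, ?_⟩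
  simp only [Set.mem_ofPred_eq] at hps ⊢
  rwa [endVertex_eq_of_mem_cylinder hq]

variable [Fintype V] {μ : Measure B.PathSpace} [IsProbabilityMeasure μ] {lam : ℝ} {x : V → ℝ}
  {α : Finset V}

lemma IsEigenvectorOf.vecMul_block (hx : B.IsEigenvectorOf α lam x) (hα : B.IsClass α) :
    (fun a : α => x a) ᵥ* (B.block α).map (Nat.cast : ℕ → ℝ) = lam • fun a : α => x a :=
  funext fun w => hx.sum_block_eq (fun _ hw _ => hx.mem_of_edge hα hw) w

/-- A set of paths that, up to vertices of weight zero, end in `α` has its measure determined by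
the prefixes ending in `α`. -/
lemma IsDefinedBy.real_eq_sum_class (hμ : IsDefinedBy μ lam x) (hx : ∀ i, 0 ≤ x i)
    (hlam : 0 ≤ lam) {n : ℕ} {U : Set B.PathSpace} (hU : ∀ p ∈ U, cylinder p n ⊆ U)
    (hUα : ∀ p ∈ U, x (endVertex p n) ≠ 0 → endVertex p n ∈ α) :
    μ.real U = (∑ a : α, x a * (prefixes U n a).ncard) / lam ^ n := by
  rw [hμ.real_eq_sum hx hlam hU, Finset.sum_coe_sort α fun a => x a * ((prefixes U n a).ncard : ℝ),
    Finset.sum_div]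
  simp only [mul_div_assoc', mul_comm (x _)]
  symm
  refine Finset.sum_subset (Finset.subset_univ α) fun v _ hv => ?_
  by_cases hxv : x v = 0
  · simp [hxv]
  · have h : prefixes U n v = ∅ := by
      rw [prefixes, Set.image_eq_empty, Set.eq_empty_iff_forall_notMem]
      rintro p ⟨hp, rfl⟩
      exact hv (hUα p hp hxv)
    rw [h, Set.ncard_empty, Nat.cast_zero, zero_mul, zero_div]

variable [DecidableEq V]

lemma IsEigenvectorOf.dotProduct_block_pow (hx : B.IsEigenvectorOf α lam x) (hα : B.IsClass α)
    (z : α → ℤ) (k : ℕ) :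
    ∑ a : α, x a * (((B.block α).map (Nat.cast : ℕ → ℤ) ^ k *ᵥ z) a : ℤ) =
      lam ^ k * ∑ a : α, x a * z a := by
  induction k with
  | zero => simp
  | succ k ih =>
    rw [pow_succ', ← mulVec_mulVec]
    set y := (B.block α).map (Nat.cast : ℕ → ℤ) ^ k *ᵥ z
    have h1 : (fun a : α => ((((B.block α).map (Nat.cast : ℕ → ℤ) *ᵥ y) a : ℤ) : ℝ)) =
        (B.block α).map (Nat.cast : ℕ → ℝ) *ᵥ fun a => (y a : ℝ) := by
      funext a
      simp [mulVec, dotProduct]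
    have h2 := dotProduct_mulVec (fun a : α => x a) ((B.block α).map (Nat.cast : ℕ → ℝ))
      fun a => (y a : ℝ)
    rw [hx.vecMul_block hα, ← h1, smul_dotProduct] at h2
    refine h2.trans ?_
    rw [pow_succ', mul_assoc, ← ih]
    rfl

lemma IsEigenvectorOf.pow_mul_mem_closure (hx : B.IsEigenvectorOf α lam x) (hα : B.IsClass α)
    {g : ℝ} (hg : g ∈ AddSubgroup.closure (x '' (α : Set V))) (k : ℕ) :
    lam ^ k * g ∈ AddSubgroup.closure (x '' (α : Set V)) := by
  obtain ⟨z, rfl⟩ := mem_closure_image_iff.1 hg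
  exact mem_closure_image_iff.2 ⟨_, hx.dotProduct_block_pow hα z k⟩

/-- The numbers of prefixes ending in the class grow at least as prescribed by its block. -/
lemma block_pow_mulVec_ncard_le {U : Set B.PathSpace} {n : ℕ}
    (hU : ∀ p ∈ U, cylinder p n ⊆ U) (k : ℕ) (a : α) :
    ((B.block α).map (Nat.cast : ℕ → ℤ) ^ k *ᵥ fun b : α => ((prefixes U n b).ncard : ℤ)) a ≤
      (prefixes U (n + k) a).ncard := by
  induction k generalizing a with
  | zero => simp
  | succ k ih =>
    rw [pow_succ', ← mulVec_mulVec]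
    have hU' : ∀ p ∈ U, cylinder p (n + k) ⊆ U := fun p hp =>
      (cylinder_anti p (Nat.le_add_right n k)).trans (hU p hp)
    have h1 := sum_F_mul_ncard_prefixes_le hU' (a : V)
    calc _ ≤ ∑ b : α, (B.F a b : ℤ) * (prefixes U (n + k) b).ncard :=
          Finset.sum_le_sum fun b _ => mul_le_mul_of_nonneg_left (ih b) (Nat.cast_nonneg _)
      _ = ∑ b ∈ α, (B.F a b : ℤ) * (prefixes U (n + k) b).ncard :=
          Finset.sum_coe_sort α fun b => (B.F a b : ℤ) * (prefixes U (n + k) b).ncard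
      _ ≤ ∑ b, (B.F a b : ℤ) * (prefixes U (n + k) b).ncard :=
          Finset.sum_le_sum_of_subset_of_nonneg (Finset.subset_univ _) fun b _ _ => by positivity
      _ ≤ _ := by exact_mod_cast h1

/-- If the group condition holds, the suitably scaled measure of a clopen set is an integer
combination `z` of the weights of the class `α`. Because the block of `α` is primitive, a power of
it makes `z` a vector of path numbers that are available in any clopen set of larger measure. -/
lemma IsEigenvectorOf.isGoodMeasure (hx : B.IsEigenvectorOf α lam x) (hα : B.IsClass α)
    (hpos : ∀ a ∈ α, 0 < x a) (hlam : 0 < lam) (hμ : IsDefinedBy μ lam x)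
    (herg : IsTailErgodic μ) {R : ℕ} (hR : ∀ i ∈ B.accessible α, i ∉ α →
      lam ^ R * x i ∈ AddSubgroup.closure (x '' (α : Set V))) : IsGoodMeasure μ := by
  intro U' hU' U hU hlt
  have hlt' : μ.real U < μ.real U' := ENNReal.toReal_strict_mono (measure_ne_top μ U') hlt
  rcases (measureReal_nonneg (μ := μ) (s := U)).eq_or_lt with h0 | hUpos
  · refine ⟨∅, isClopen_empty, Set.empty_subset _, ?_⟩
    rw [measure_empty, (measureReal_eq_zero_iff).1 h0.symm]
  have hR' : ∀ i, lam ^ R * x i ∈ AddSubgroup.closure (x '' (α : Set V)) := by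
    intro i
    by_cases hi : i ∈ α
    · exact hx.pow_mul_mem_closure hα (AddSubgroup.subset_closure ⟨i, hi, rfl⟩) R
    by_cases hi' : i ∈ B.accessible α
    · exact hR i hi' hi
    · rw [hx.zero_off i hi', mul_zero]
      exact AddSubgroup.zero_mem _
  obtain ⟨n, hn⟩ := exists_forall_cylinder_subset hU
  obtain ⟨n', hn'⟩ := exists_forall_cylinder_subset hU'
  -- at least `R` steps beyond the length that determines `U`, to use the group condition
  obtain ⟨N, hNlt, hNn'⟩ := ((hx.eventually_lt_real hα hpos hlam hμ herg U' hlt').and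
    (Filter.eventually_ge_atTop (max n' (n + R)))).exists
  have hNU' := forall_cylinder_subset_inter (hn' N ((le_max_left _ _).trans hNn')) (α : Set V)
  set U'' := U' ∩ {p | endVertex p N ∈ (α : Set V)} with hU''
  have hNR : n ≤ N - R := Nat.le_sub_of_add_le ((le_max_right _ _).trans hNn')
  have hRN : R + (N - R) = N :=
    Nat.add_sub_cancel' ((Nat.le_add_left R n).trans ((le_max_right _ _).trans hNn'))
  have hmem : lam ^ N * μ.real U ∈ AddSubgroup.closure (x '' (α : Set V)) := by
    rw [hμ.real_eq_sum hx.nonneg hlam.le (hn _ hNR), Finset.mul_sum]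
    refine AddSubgroup.sum_mem _ fun v _ => ?_
    have h1 : lam ^ N * ((prefixes U (N - R) v).ncard * (x v / lam ^ (N - R))) =
        (prefixes U (N - R) v).ncard • (lam ^ R * x v) := by
      rw [nsmul_eq_mul, ← hRN, pow_add, hRN]
      field_simp
    rw [h1]
    exact AddSubgroup.nsmul_mem _ (hR' v) _
  obtain ⟨z, hz⟩ := mem_closure_image_iff.1 hmem
  set c : α → ℤ := fun a => ((prefixes U'' N a).ncard : ℤ) with hc
  have hcsum : ∑ a : α, x a * (c a : ℝ) = lam ^ N * μ.real U'' := by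
    rw [hμ.real_eq_sum_class (α := α) hx.nonneg hlam.le hNU' fun p hp _ => hp.2,
      mul_div_cancel₀ _ (pow_pos hlam N).ne']
    simp [hc]
  obtain ⟨M, hM⟩ := hx.exists_block_pow_pos hα hpos hlam hμ herg
  obtain ⟨k₁, hk₁⟩ := exists_pow_mulVec_nonneg hM (x := fun a : α => x a) (fun a => hpos a a.2)
    hlam (hx.vecMul_block hα) (z := z) (by rw [hz]; exact mul_pos (pow_pos hlam N) hUpos)
  obtain ⟨k₂, hk₂⟩ := exists_pow_mulVec_nonneg hM (x := fun a : α => x a) (fun a => hpos a a.2)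
    hlam (hx.vecMul_block hα) (z := c - z) (by
      simp only [Pi.sub_apply, Int.cast_sub, mul_sub, Finset.sum_sub_distrib]
      rw [hz, hcsum, ← mul_sub]
      exact mul_pos (pow_pos hlam N) (sub_pos.2 hNlt))
  set P := (B.block α).map (Nat.cast : ℕ → ℤ) with hP
  have hPk : ∀ (k : ℕ) (y : α → ℤ), (∀ a, 0 ≤ y a) → ∀ a, 0 ≤ (P ^ k *ᵥ y) a := by
    intro k
    induction k with
    | zero => simp
    | succ k ih =>
      intro y hy
      rw [pow_succ, ← mulVec_mulVec]
      exact ih _ fun a => Finset.sum_nonneg fun b _ => mul_nonneg (Nat.cast_nonneg _) (hy b)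
  -- nonnegativity persists under further powers, so that `k₁ + k₂` serves both vectors
  have hz0 : ∀ a, 0 ≤ (P ^ (k₁ + k₂) *ᵥ z) a := by
    rw [add_comm, pow_add, ← mulVec_mulVec]
    exact hPk k₂ _ hk₁
  have hzc : ∀ a, (P ^ (k₁ + k₂) *ᵥ z) a ≤ (prefixes U'' (N + (k₁ + k₂)) a).ncard := by
    intro a
    have h1 : 0 ≤ (P ^ (k₁ + k₂) *ᵥ (c - z)) a := by
      rw [pow_add, ← mulVec_mulVec]
      exact hPk k₁ _ hk₂ a
    rw [mulVec_sub, Pi.sub_apply, sub_nonneg] at h1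
    exact h1.trans (block_pow_mulVec_ncard_le hNU' (k₁ + k₂) a)
  set y := P ^ (k₁ + k₂) *ᵥ z with hy
  obtain ⟨W, hW, hWU, hWμ⟩ := hμ.exists_isClopen_subset hx.nonneg hlam.le
    (n := N + (k₁ + k₂)) (U := U'')
    (fun p hp => (cylinder_anti p (Nat.le_add_right _ _)).trans (hNU' p hp))
    (fun v => if h : v ∈ α then (y ⟨v, h⟩).toNat else 0) (by
      intro v
      split_ifs with h
      · exact Int.toNat_le.2 (hzc ⟨v, h⟩)
      · exact Nat.zero_le _)
  refine ⟨W, hW, hWU.trans Set.inter_subset_left, ?_⟩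
  refine (ENNReal.toReal_eq_toReal_iff' (measure_ne_top μ W) (measure_ne_top μ U)).1 ?_
  change μ.real W = μ.real U
  have h1 : μ.real W = (∑ a : α, x a * (y a : ℝ)) / lam ^ (N + (k₁ + k₂)) := by
    rw [hWμ, Finset.sum_div, ← Finset.sum_subset (Finset.subset_univ α) fun v _ hv => by simp [hv],
      ← Finset.sum_coe_sort]
    refine Finset.sum_congr rfl fun a _ => ?_
    have h2 : (((y a).toNat : ℕ) : ℝ) = (y a : ℝ) := by exact_mod_cast Int.toNat_of_nonneg (hz0 a)
    rw [dif_pos a.2, h2]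
    ring
  rw [h1, hy, hP, hx.dotProduct_block_pow hα, hz, add_comm N, pow_add _ _ N]
  field_simp

/-- Conversely, a good measure realises the weight of a vertex by a clopen set of paths that have
already entered the class `α`. -/
lemma IsEigenvectorOf.exists_pow_mul_mem_closure (hx : B.IsEigenvectorOf α lam x)
    (hα : B.IsClass α) (hpos : ∀ a ∈ α, 0 < x a) (hlam : 0 < lam) (hμ : IsDefinedBy μ lam x)
    (herg : IsTailErgodic μ) (hgood : IsGoodMeasure μ) {i : V} (hi : i ∉ α) :
    ∃ R : ℕ, lam ^ R * x i ∈ AddSubgroup.closure (x '' (α : Set V)) := by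
  -- a path may also start at a vertex of `α`, so that the weight `x i` is less than `1`
  have hi1 : x i < μ.real Set.univ := by
    rw [probReal_univ, ← hx.normalised]
    obtain ⟨a, ha⟩ := hα.nonempty
    have hh : ∀ v, x v ≤ B.h v * x v := fun v =>
      le_mul_of_one_le_left (hx.nonneg v) (by exact_mod_cast B.h_pos v)
    have hia : i ≠ a := by rintro rfl; exact hi ha
    calc x i < x i + x a := lt_add_of_pos_right _ (hpos a ha)
      _ ≤ ∑ v ∈ {i, a}, (B.h v : ℝ) * x v := by
        rw [Finset.sum_pair hia]
        exact add_le_add (hh i) (hh a)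
      _ ≤ _ := Finset.sum_le_sum_of_subset_of_nonneg (Finset.subset_univ _) fun v _ _ =>
        mul_nonneg (Nat.cast_nonneg _) (hx.nonneg v)
  obtain ⟨N, hN⟩ := (hx.eventually_lt_real hα hpos hlam hμ herg Set.univ hi1).exists
  rw [Set.univ_inter] at hN
  obtain ⟨p₀⟩ := nonempty_of_isProbabilityMeasure μ
  obtain ⟨q, rfl⟩ := exists_endVertex_zero_eq p₀ i
  have hq : μ.real (cylinder q 0) = x (endVertex q 0) := by
    rw [hμ.real_cylinder hx.nonneg hlam.le, pow_zero, div_one]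
  obtain ⟨W, hW, hWN, hWq⟩ := hgood {p | endVertex p N ∈ (α : Set V)}
    (isClopen_endVertex_mem _ N) (cylinder q 0) (isClopen_cylinder q 0)
    ((ENNReal.toReal_lt_toReal (measure_ne_top μ _) (measure_ne_top μ _)).1 (hq.trans_lt hN))
  obtain ⟨m, hm⟩ := exists_forall_cylinder_subset hW
  refine ⟨max m N, mem_closure_image_iff.2
    ⟨fun a => ((prefixes W (max m N) a).ncard : ℤ), ?_⟩⟩
  have h1 := hμ.real_eq_sum_class (α := α) hx.nonneg hlam.le (hm _ (le_max_left m N))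
    fun p hp hxp => hx.endVertex_mem hα (le_max_right m N) (hWN hp) hxp
  rw [Measure.real, hWq, ← Measure.real, hq] at h1
  rw [h1, mul_div_cancel₀ _ (pow_pos hlam _).ne']
  simp

lemma IsEigenvectorOf.isGoodMeasure_iff (hx : B.IsEigenvectorOf α lam x) (hα : B.IsClass α)
    (hpos : ∀ a ∈ α, 0 < x a) (hlam : 0 < lam) (hμ : IsDefinedBy μ lam x)
    (herg : IsTailErgodic μ) : IsGoodMeasure μ ↔ ∃ R : ℕ, ∀ i ∈ B.accessible α, i ∉ α →
      lam ^ R * x i ∈ AddSubgroup.closure (x '' (α : Set V)) := by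
  refine ⟨fun hgood => ?_, fun ⟨R, hR⟩ => hx.isGoodMeasure hα hpos hlam hμ herg hR⟩
  choose! r hr using fun i (hi : i ∉ α) =>
    hx.exists_pow_mul_mem_closure hα hpos hlam hμ herg hgood hi
  refine ⟨Finset.univ.sup r, fun i _ hi => ?_⟩
  have h1 : r i ≤ Finset.univ.sup r := Finset.le_sup (Finset.mem_univ i)
  rw [← Nat.sub_add_cancel h1, pow_add, mul_assoc]
  exact hx.pow_mul_mem_closure hα (hr i hi) _

end StationaryBratteli

/-! ### Rational eigenvectors -/

lemma exists_sum_mul_eq_natGcd {ι : Type*} (s : Finset ι) (p : ι → ℕ) :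
    ∃ u : ι → ℤ, ∑ i ∈ s, (p i : ℤ) * u i = (s.gcd p : ℕ) := by
  obtain ⟨u, hu⟩ := Finset.gcd_eq_sum_mul s fun i => (p i : ℤ)
  have h1 : (s.gcd fun i => (p i : ℤ)).natAbs ∣ s.gcd p := Finset.dvd_gcd fun i hi => by
    have := Int.natAbs_dvd_natAbs.2 (Finset.gcd_dvd (f := fun i => (p i : ℤ)) hi)
    rwa [Int.natAbs_natCast] at this
  obtain ⟨c, hc⟩ := Int.natAbs_dvd.1 (Int.natCast_dvd_natCast.2 h1)
  refine ⟨fun i => u i * c, ?_⟩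
  rw [hc, hu, Finset.sum_mul]
  exact Finset.sum_congr rfl fun i _ => (mul_assoc _ _ _).symm

/-- The group generated by the fractions `p a / q` consists of the multiples of their common
numerator divided by `q`. -/
lemma div_mem_closure_image_iff {V : Type*} {α : Finset V} {x : V → ℝ} {p : V → ℕ} {q : ℕ}
    (hq : 0 < q) (hp : ∀ a ∈ α, x a = (p a : ℝ) / (q : ℝ)) (m : ℕ) :
    (m : ℝ) / q ∈ AddSubgroup.closure (x '' (α : Set V)) ↔ α.gcd p ∣ m := by
  have hq' : (q : ℝ) ≠ 0 := Nat.cast_ne_zero.2 hq.ne'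
  have key : ∀ z : α → ℤ, ∑ a : α, x a * z a = ((∑ a : α, (p a : ℤ) * z a : ℤ) : ℝ) / q := by
    intro z
    push_cast
    rw [Finset.sum_div]
    refine Finset.sum_congr rfl fun a _ => ?_
    rw [hp a a.2]
    ring
  rw [mem_closure_image_iff]
  constructor
  · rintro ⟨z, hz⟩
    rw [key, div_left_inj' hq'] at hz
    have h1 : ∑ a : α, (p a : ℤ) * z a = (m : ℤ) := by exact_mod_cast hz
    rw [← Int.natCast_dvd_natCast, ← h1]
    exact Finset.dvd_sum fun a _ =>
      (Int.natCast_dvd_natCast.2 (Finset.gcd_dvd a.2)).mul_right _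
  · rintro ⟨c, rfl⟩
    obtain ⟨u, hu⟩ := exists_sum_mul_eq_natGcd α p
    refine ⟨fun a => u a * c, ?_⟩
    rw [key]
    congr 1
    simp only [← mul_assoc, ← Finset.sum_mul]
    rw [Finset.sum_coe_sort α fun a => (p a : ℤ) * u a, hu]
    push_cast
    ring

namespace StationaryBratteli

variable {V : Type*} [Fintype V] {B : StationaryBratteli V} {lam : ℝ} {x : V → ℝ} {α : Finset V}

/-- An eigenvalue with a primitive integer eigenvector is an integer, as one sees by applying the
eigenvalue equation to a Bézout combination of the entries. -/
lemma IsEigenvectorOf.exists_nat_eq (hx : B.IsEigenvectorOf α lam x) (hlam : 0 ≤ lam)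
    {p : V → ℕ} {q : ℕ} (hq : 0 < q) (hp : ∀ i ∈ B.accessible α, x i = (p i : ℝ) / (q : ℝ))
    (hgcd : (B.accessible α).gcd p = 1) : ∃ l : ℕ, (l : ℝ) = lam := by
  have hq' : (q : ℝ) ≠ 0 := Nat.cast_ne_zero.2 hq.ne'
  obtain ⟨u, hu⟩ := exists_sum_mul_eq_natGcd (B.accessible α) p
  rw [hgcd] at hu
  have h1 : ∀ w ∈ B.accessible α,
      lam * p w = ((∑ v ∈ B.accessible α, (B.F v w : ℤ) * p v : ℤ) : ℝ) := by
    intro w hw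
    have h2 := hx.sum_eq w
    rw [← Finset.sum_subset (Finset.subset_univ (B.accessible α)) fun v _ hv => by
        rw [hx.zero_off v hv, mul_zero],
      Finset.sum_congr rfl fun v hv => by rw [hp v hv, mul_div_assoc'], ← Finset.sum_div,
      hp w hw, mul_div_assoc', div_left_inj' hq'] at h2
    push_cast
    exact h2.symm
  have h2 : lam =
      ((∑ w ∈ B.accessible α, (∑ v ∈ B.accessible α, (B.F v w : ℤ) * p v) * u w : ℤ) : ℝ) := by
    calc lam = lam * ((∑ i ∈ B.accessible α, (p i : ℤ) * u i : ℤ) : ℝ) := by rw [hu]; simp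
      _ = _ := by
        rw [Int.cast_sum, Int.cast_sum, Finset.mul_sum]
        refine Finset.sum_congr rfl fun w hw => ?_
        rw [Int.cast_mul, Int.cast_mul, ← h1 w hw, Int.cast_natCast, mul_assoc]
  obtain ⟨l, hl⟩ := Int.eq_ofNat_of_zero_le (Int.cast_nonneg_iff.1 (h2 ▸ hlam))
  exact ⟨l, by rw [h2, hl]; rfl⟩

lemma exists_pow_mul_mem_closure_iff_gcd_dvd {p : V → ℕ} {q l : ℕ} (hq : 0 < q)
    (hα : α ⊆ B.accessible α)
    (hp : ∀ i ∈ B.accessible α, x i = (p i : ℝ) / (q : ℝ)) (hgcd : (B.accessible α).gcd p = 1) :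
    (∃ R : ℕ, ∀ i ∈ B.accessible α, i ∉ α →
      (l : ℝ) ^ R * x i ∈ AddSubgroup.closure (x '' (α : Set V))) ↔
    ∃ R : ℕ, α.gcd p ∣ l ^ R := by
  have h1 : ∀ R, ∀ i ∈ B.accessible α,
      (l : ℝ) ^ R * x i ∈ AddSubgroup.closure (x '' (α : Set V)) ↔ α.gcd p ∣ l ^ R * p i := by
    intro R i hi
    rw [← div_mem_closure_image_iff hq fun a ha => hp a (hα ha), hp i hi]
    push_cast
    rw [mul_div_assoc']
  refine exists_congr fun R => ⟨fun h => ?_, fun h i hi _ => (h1 R i hi).2 (h.mul_right _)⟩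
  have h2 : α.gcd p ∣ (B.accessible α).gcd fun i => l ^ R * p i := Finset.dvd_gcd fun i hi => by
    by_cases hiα : i ∈ α
    · exact (Finset.gcd_dvd hiα).mul_left _
    · exact (h1 R i hi).1 (h i hi hiα)
  rwa [Finset.gcd_mul_left, hgcd, mul_one, normalize_eq] at h2

end StationaryBratteli

theorem mainTheorem2 {V : Type*} [Fintype V] [DecidableEq V] (B : StationaryBratteli V)
    (α : Finset V) (hα : B.IsDistinguishedClass α)
    (lam : ℝ) (hlam : lam = B.rho α)
    (x : V → ℝ) (hx : B.IsEigenvectorOf α lam x)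
    (μ : Measure B.PathSpace) [IsProbabilityMeasure μ] [NullSingletonClass μ]
    (hinv : StationaryBratteli.IsTailInvariant μ) (herg : StationaryBratteli.IsTailErgodic μ)
    (hμ : StationaryBratteli.IsDefinedBy μ lam x) :
    (IsGoodMeasure (onSupport μ) ↔
      ∃ R : ℕ, ∀ i ∈ B.accessible α, i ∉ α →
        lam ^ R * x i ∈ AddSubgroup.closure (x '' (α : Set V))) ∧
    (clopenValues (onSupport μ) ⊆ Set.range (Rat.cast : ℚ → ℝ) →
      ∀ (p : V → ℕ) (q : ℕ), 0 < q → (∀ i ∈ B.accessible α, x i = (p i : ℝ) / (q : ℝ)) →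
        (B.accessible α).gcd p = 1 →
        ∃ l : ℕ, (l : ℝ) = lam ∧
          (IsGoodMeasure (onSupport μ) ↔ ∃ R : ℕ, α.gcd p ∣ l ^ R)) := by
  have hlam0 : 0 < lam := hx.pos_of_nonneg (hlam ▸ ENNReal.toReal_nonneg)
  have hsub : α ⊆ B.accessible α := fun a ha =>
    StationaryBratteli.mem_accessible.2 ⟨a, ha, .refl⟩
  have hpos : ∀ a ∈ α, 0 < x a := fun a ha =>
    (hx.nonneg a).lt_of_ne' ((hx.ne_zero_iff hα hlam0 hlam).2 (hsub ha))
  have hgood := (isGoodMeasure_onSupport_iff μ).trans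
    (hx.isGoodMeasure_iff hα.1 hpos hlam0 hμ herg)
  refine ⟨hgood, fun _ p q hq hp hgcd => ?_⟩
  obtain ⟨l, rfl⟩ := hx.exists_nat_eq hlam0.le hq hp hgcd
  exact ⟨l, rfl, hgood.trans
    (StationaryBratteli.exists_pow_mul_mem_closure_iff_gcd_dvd hq hsub hp hgcd)⟩
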